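/- Let $\mu$ be a probability measure with infinite support on the unit circle $\partial\mathbb D=\{z\in\mathbb C:|z|=1\}$. Let $\Phi_n$ ($n\ge 0$) be its monic orthogonal polynomials: $\Phi_n$ is monic of degree $n$ and orthogonal in $L^2(\mu)$ to all polynomials of degree less than $n$. Let $\Phi_n^*(z)=z^n\,\overline{\Phi_n(1/\bar z)}$ be the reversed polynomials, and let $\alpha_n=-\overline{\Phi_{n+1}(0)}$ ($n\ge 0$) be the Verblunsky coefficients, so that $\Phi_{n+1}(z)=z\Phi_n(z)-\bar\alpha_n\Phi_n^*(z)$. Then the ratios $$\Omega_n(z)=\frac{\Phi_{n+1}^*(z)}{\Phi_n^*(z)}$$ converge uniformly on compact subsets of $\mathbb D=\{z\in\mathbb C:|z|<1\}$ as $n\to\infty$ if and only if for each integer $\ell\ge 1$ there is $c_\ell\in\overline{\mathbb D}$ such that $$\lim_{n\to\infty}\alpha_n\,\overline{\alpha_{n-\ell}}=c_\ell .$$ Moreover, if these limits exist for all $\ell\ge 1$, then there are $a\in[0,1]$ and $\lambda\in\mathbb C$ with $|\lambda|=1$ such that $c_\ell=a^2\lambda^\ell$ for all $\ell\ge 1$,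 and $$\lim_{n\to\infty}\Omega_n(z)=G_a(\lambda z)\quad\text{uniformly on compact subsets of }\mathbb D,\qquad G_a(z)=\tfrac12\Bigl(1+z+\sqrt{(1-z)^2+4a^2z}\Bigr),$$ where $\sqrt{\cdot}$ is the principal branch of the square root. -/

import Mathlib

open Polynomial MeasureTheory Filter Topology
open scoped ComplexConjugate

namespace OPUC

/-- The `L²(μ)` inner product `∫ conj (P z) * Q z dμ(z)` of two polynomials on the unit circle. -/
noncomputable def innerProd (μ : Measure (Metric.sphere (0 : ℂ) 1)) (P Q : ℂ[X]) : ℂ :=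
  ∫ z : Metric.sphere (0 : ℂ) 1, conj (P.eval (z : ℂ)) * Q.eval (z : ℂ) ∂μ

/-- The monic orthogonal polynomials `Φ_n` of `μ`, obtained by applying the Gram–Schmidt
process in `L²(μ)` to the monomials `1, z, z², …`, without normalization. -/
noncomputable def monicPoly (μ : Measure (Metric.sphere (0 : ℂ) 1)) : ℕ → ℂ[X]
  | n => X ^ n - ∑ k : Fin n,
      C (innerProd μ (monicPoly μ k) (X ^ n) / innerProd μ (monicPoly μ k) (monicPoly μ k)) *
        monicPoly μ k

/-- The reversed polynomials `Φ_n^*(z) = z ^ n * conj (Φ_n (1 / conj z))`: the coefficient of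
`z ^ i` in `Φ_n^*` is the complex conjugate of the coefficient of `z ^ (n - i)` in `Φ_n`. -/
noncomputable def reversedPoly (μ : Measure (Metric.sphere (0 : ℂ) 1)) (n : ℕ) : ℂ[X] :=
  ((monicPoly μ n).map (starRingEnd ℂ)).reflect n

/-- The Verblunsky coefficients `α_n` of `μ`, `n ≥ 0`, given by `Φ_{n+1}(0) = - conj α_n`. This is
the value at `0` of the recurrence `Φ_{n+1}(z) = z Φ_n(z) - conj α_n * Φ_n^*(z)`. -/
noncomputable def verblunsky (μ : Measure (Metric.sphere (0 : ℂ) 1)) (n : ℕ) : ℂ :=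
  - conj ((monicPoly μ (n + 1)).eval 0)

/-- The ratio `Ω_n = Φ_{n+1}^* / Φ_n^*`. -/
noncomputable def ratio (μ : Measure (Metric.sphere (0 : ℂ) 1)) (n : ℕ) (z : ℂ) : ℂ :=
  (reversedPoly μ (n + 1)).eval z / (reversedPoly μ n).eval z

/-- `F n → G` uniformly on every compact subset of the open unit disk. -/
def ConvergesOnCompacts (F : ℕ → ℂ → ℂ) (G : ℂ → ℂ) : Prop :=
  ∀ K : Set ℂ, IsCompact K → K ⊆ Metric.ball (0 : ℂ) 1 → TendstoUniformlyOn F G atTop K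

/-- `G_a(z) = (1 + z + √((1 - z)² + 4 a² z)) / 2`, with the principal branch of the square root. -/
noncomputable def G (a : ℝ) (z : ℂ) : ℂ :=
  (1 / 2) * (1 + z + Complex.sqrt ((1 - z) ^ 2 + 4 * (a : ℂ) ^ 2 * z))

end OPUC

/-! Put `T n l` for the Taylor series at 0 of α_{n+l} Φ_n/Φ_n^*, and β n l = α_{n+l} conj α_n. The
Szegő recurrence gives Ω_n = 1 - z T n 0 (`taylorAtZero_ratio`), and division by Φ_n^* gives z T n
(l+1) = (1 - z T n 0) T (n+1) l + β n (l+1) (`X_mul_schurSeries_succ`). The extra index l closes the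
system.

In the disk Φ_n^* has no zeros and |Ω_n| ≤ 2, so locally uniform convergence of Ω_n to the analytic
candidate amounts to convergence of Taylor coefficients, and the theorem becomes one about formal
power series. If T n 0 converges, the recurrence makes every T n l converge, and its constant term
yields the limit of β. If every β n l converges, the recurrence determines each coefficient from
lower ones, so T n l tends to the solution of the limiting recurrence.

Limits of α_{n+l} conj α_n must be a² λ^l because |α_n|² converges as soon as one limit is nonzero
(`exists_eq_sq_mul_pow_of_tendsto`). The limiting recurrence is then solved by λ^l V, where 1 - zV
satisfies the quadratic equation of G_a(λz). -/

namespace OPUC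

/-! ### The sesquilinear form on polynomials and its definiteness. -/

section InnerProduct

variable (μ : Measure (Metric.sphere (0 : ℂ) 1))

lemma continuous_innerProd_integrand (P Q : ℂ[X]) :
    Continuous fun z : Metric.sphere (0 : ℂ) 1 => conj (P.eval (z : ℂ)) * Q.eval (z : ℂ) := by
  have hP : Continuous fun z : Metric.sphere (0 : ℂ) 1 => P.eval (z : ℂ) :=
    P.continuous.comp continuous_subtype_val
  have hQ : Continuous fun z : Metric.sphere (0 : ℂ) 1 => Q.eval (z : ℂ) :=
    Q.continuous.comp continuous_subtype_val
  exact (Complex.continuous_conj.comp hP).mul hQ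

lemma integrable_innerProd_integrand [IsProbabilityMeasure μ] (P Q : ℂ[X]) :
    Integrable (fun z : Metric.sphere (0 : ℂ) 1 =>
      conj (P.eval (z : ℂ)) * Q.eval (z : ℂ)) μ :=
  (continuous_innerProd_integrand P Q).integrable_of_hasCompactSupport
    (HasCompactSupport.of_compactSpace _)

lemma innerProd_conj_symm (P Q : ℂ[X]) : conj (innerProd μ P Q) = innerProd μ Q P := by
  unfold innerProd
  rw [← integral_conj]
  congr 1
  ext z
  simp [mul_comm]

lemma innerProd_add_right [IsProbabilityMeasure μ] (P Q R : ℂ[X]) :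
    innerProd μ P (Q + R) = innerProd μ P Q + innerProd μ P R := by
  unfold innerProd
  rw [← integral_add (integrable_innerProd_integrand μ P Q)
    (integrable_innerProd_integrand μ P R)]
  simp [mul_add]

lemma innerProd_C_mul_right (P Q : ℂ[X]) (c : ℂ) :
    innerProd μ P (C c * Q) = c * innerProd μ P Q := by
  unfold innerProd
  rw [← integral_const_mul]
  congr 1
  ext z
  simp only [eval_mul, eval_C]
  ring

lemma innerProd_neg_right (P Q : ℂ[X]) : innerProd μ P (-Q) = -innerProd μ P Q := by
  simpa using innerProd_C_mul_right μ P Q (-1)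

lemma innerProd_sub_right [IsProbabilityMeasure μ] (P Q R : ℂ[X]) :
    innerProd μ P (Q - R) = innerProd μ P Q - innerProd μ P R := by
  rw [sub_eq_add_neg, innerProd_add_right, innerProd_neg_right, sub_eq_add_neg]

lemma innerProd_sum_right [IsProbabilityMeasure μ] {ι : Type*} (s : Finset ι) (P : ℂ[X]) (f : ι → ℂ[X]) :
    innerProd μ P (∑ i ∈ s, f i) = ∑ i ∈ s, innerProd μ P (f i) := by
  unfold innerProd
  rw [← integral_finsetSum s fun i _ => integrable_innerProd_integrand μ P (f i)]
  simp [eval_finsetSum, Finset.mul_sum]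

lemma innerProd_add_left [IsProbabilityMeasure μ] (P Q R : ℂ[X]) :
    innerProd μ (P + Q) R = innerProd μ P R + innerProd μ Q R := by
  rw [← innerProd_conj_symm, innerProd_add_right, map_add, innerProd_conj_symm,
    innerProd_conj_symm]

lemma innerProd_sub_left [IsProbabilityMeasure μ] (P Q R : ℂ[X]) :
    innerProd μ (P - Q) R = innerProd μ P R - innerProd μ Q R := by
  rw [← innerProd_conj_symm, innerProd_sub_right, map_sub, innerProd_conj_symm,
    innerProd_conj_symm]

lemma innerProd_C_mul_left (P Q : ℂ[X]) (c : ℂ) :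
    innerProd μ (C c * P) Q = conj c * innerProd μ P Q := by
  rw [← innerProd_conj_symm, innerProd_C_mul_right, map_mul, innerProd_conj_symm]

lemma conj_mul_self_of_sphere (z : Metric.sphere (0 : ℂ) 1) : conj (z : ℂ) * z = 1 := by
  rw [mul_comm, Complex.mul_conj, Complex.normSq_eq_norm_sq]
  simp

lemma innerProd_X_mul_X_mul (P Q : ℂ[X]) :
    innerProd μ (X * P) (X * Q) = innerProd μ P Q := by
  unfold innerProd
  congr 1
  ext z
  simp only [eval_mul, eval_X, map_mul]
  linear_combination (conj (P.eval (z : ℂ)) * Q.eval (z : ℂ)) * conj_mul_self_of_sphere z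

lemma innerProd_self_eq_integral (P : ℂ[X]) :
    innerProd μ P P = ((∫ z : Metric.sphere (0 : ℂ) 1, ‖P.eval (z : ℂ)‖ ^ 2 ∂μ : ℝ) : ℂ) := by
  unfold innerProd
  rw [← integral_complex_ofReal]
  congr 1
  ext z
  rw [mul_comm, Complex.mul_conj, Complex.normSq_eq_norm_sq]

variable {μ}

/-- A null polynomial vanishes on the closed support, hence has infinitely many roots. -/
lemma eq_zero_of_innerProd_self [IsProbabilityMeasure μ] (hμ : μ.support.Infinite) {P : ℂ[X]}
    (h : innerProd μ P P = 0) : P = 0 := by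
  rw [innerProd_self_eq_integral, Complex.ofReal_eq_zero] at h
  have hc : Continuous fun z : Metric.sphere (0 : ℂ) 1 => P.eval (z : ℂ) :=
    P.continuous.comp continuous_subtype_val
  have hint : Integrable (fun z : Metric.sphere (0 : ℂ) 1 => ‖P.eval (z : ℂ)‖ ^ 2) μ :=
    (hc.norm.pow 2).integrable_of_hasCompactSupport (HasCompactSupport.of_compactSpace _)
  rw [integral_eq_zero_iff_of_nonneg (fun z => by positivity) hint] at h
  have hcl : IsClosed {z : Metric.sphere (0 : ℂ) 1 | P.eval (z : ℂ) = 0} :=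
    isClosed_eq hc continuous_const
  have hsub : μ.support ⊆ {z : Metric.sphere (0 : ℂ) 1 | P.eval (z : ℂ) = 0} := by
    refine Measure.support_subset_of_isClosed hcl ?_
    filter_upwards [h] with z hz
    simpa using hz
  have hinf : (Subtype.val '' μ.support : Set ℂ).Infinite :=
    hμ.image Subtype.val_injective.injOn
  refine P.eq_zero_of_infinite_isRoot (hinf.mono ?_)
  rintro _ ⟨z, hz, rfl⟩
  exact hsub hz

end InnerProduct

/-! ### Orthogonality, the Szegő recurrence and the Verblunsky bound. -/

section Orthogonal

variable {μ : Measure (Metric.sphere (0 : ℂ) 1)}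

variable (μ) in
lemma monicPoly_sub_degree_lt (n : ℕ) : (monicPoly μ n - X ^ n).degree < (n : WithBot ℕ) := by
  induction n using Nat.strong_induction_on with
  | _ n ih =>
    rw [monicPoly.eq_def μ n, sub_right_comm, sub_self, zero_sub, degree_neg]
    refine (degree_sum_le _ _).trans_lt ?_
    rw [Finset.sup_lt_iff (by exact WithBot.bot_lt_coe n)]
    intro k _
    rw [← smul_eq_C_mul]
    refine (degree_smul_le _ _).trans_lt ?_
    have hk : monicPoly μ k = X ^ (k : ℕ) + (monicPoly μ k - X ^ (k : ℕ)) := by ring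
    rw [hk]
    refine (degree_add_le _ _).trans_lt (max_lt ?_ ?_)
    · rw [degree_X_pow]; exact_mod_cast k.2
    · exact (ih k k.2).trans (by exact_mod_cast k.2)

variable (μ) in
lemma monicPoly_monic (n : ℕ) : (monicPoly μ n).Monic := by
  have h : monicPoly μ n = X ^ n + (monicPoly μ n - X ^ n) := by ring
  rw [h]
  exact monic_X_pow_add (monicPoly_sub_degree_lt μ n)

variable (μ) in
lemma natDegree_monicPoly (n : ℕ) : (monicPoly μ n).natDegree = n := by
  have h : monicPoly μ n = X ^ n + (monicPoly μ n - X ^ n) := by ring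
  rw [h]
  apply natDegree_eq_of_degree_eq_some
  rw [degree_add_eq_left_of_degree_lt, degree_X_pow]
  rw [degree_X_pow]
  exact monicPoly_sub_degree_lt μ n

lemma innerProd_monicPoly_self_ne_zero [IsProbabilityMeasure μ] (hμ : μ.support.Infinite) (n : ℕ) :
    innerProd μ (monicPoly μ n) (monicPoly μ n) ≠ 0 := fun h =>
  (monicPoly_monic μ n).ne_zero (eq_zero_of_innerProd_self hμ h)

lemma innerProd_monicPoly_of_lt [IsProbabilityMeasure μ] (hμ : μ.support.Infinite) {k n : ℕ} (hk : k < n) :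
    innerProd μ (monicPoly μ k) (monicPoly μ n) = 0 := by
  induction n using Nat.strong_induction_on generalizing k with
  | _ n ih =>
    rw [monicPoly.eq_def μ n, innerProd_sub_right, innerProd_sum_right,
      Finset.sum_eq_single (⟨k, hk⟩ : Fin n)]
    · rw [innerProd_C_mul_right, div_mul_cancel₀ _ (innerProd_monicPoly_self_ne_zero hμ k),
        sub_self]
    · intro j _ hj
      rw [innerProd_C_mul_right]
      have hjk : (j : ℕ) ≠ k := fun h => hj (Fin.ext h)
      rcases lt_or_gt_of_ne hjk with h | h
      · have h0 : innerProd μ (monicPoly μ k) (monicPoly μ j) = 0 := by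
          rw [← innerProd_conj_symm, ih k hk h, map_zero]
        rw [h0, mul_zero]
      · rw [ih j j.2 h, mul_zero]
    · simp

lemma innerProd_monicPoly_of_degree_lt [IsProbabilityMeasure μ] (hμ : μ.support.Infinite) {n : ℕ} {P : ℂ[X]}
    (hP : P.degree < n) : innerProd μ P (monicPoly μ n) = 0 := by
  have key : ∀ m ≤ n, ∀ P : ℂ[X], P.degree < m → innerProd μ P (monicPoly μ n) = 0 := by
    intro m
    induction m with
    | zero =>
      intro _ P hP
      have : P = 0 := by
        rw [← degree_eq_bot]
        exact Nat.WithBot.lt_zero_iff.mp hP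
      simp [this, innerProd]
    | succ m ih =>
      intro hm P hP
      -- Subtracting a multiple of the monic Φ_m removes the coefficient of degree m without
      -- changing the inner product with Φ_n, since m < n.
      have hlt : (P - C (P.coeff m) * monicPoly μ m).degree < m := by
        rw [degree_lt_iff_coeff_zero]
        intro j hj
        rw [coeff_sub, coeff_C_mul]
        rcases hj.eq_or_lt with rfl | hj
        · have := (monicPoly_monic μ m).coeff_natDegree
          rw [natDegree_monicPoly] at this
          rw [this, mul_one, sub_self]
        · rw [coeff_eq_zero_of_degree_lt (hP.trans_le (by exact_mod_cast hj)),
            coeff_eq_zero_of_natDegree_lt (p := monicPoly μ m) (by rw [natDegree_monicPoly]; exact hj)]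
          ring
      have h0 := ih (by omega) _ hlt
      rw [innerProd_sub_left, innerProd_C_mul_left, innerProd_monicPoly_of_lt hμ (by omega),
        mul_zero, sub_zero] at h0
      exact h0
  exact key n le_rfl P hP

lemma eval_reflect_map_conj {P : ℂ[X]} {n : ℕ} (hP : P.natDegree ≤ n)
    (z : Metric.sphere (0 : ℂ) 1) :
    ((P.map (starRingEnd ℂ)).reflect n).eval (z : ℂ) = (z : ℂ) ^ n * conj (P.eval (z : ℂ)) := by
  have hz := conj_mul_self_of_sphere z
  have hz' : (z : ℂ) * conj (z : ℂ) = 1 := by rw [mul_comm]; exact hz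
  let i : Invertible (conj (z : ℂ)) := ⟨z, hz', hz⟩
  have h := eval₂_reflect_mul_pow (RingHom.id ℂ) (conj (z : ℂ)) n (P.map (starRingEnd ℂ))
    ((natDegree_map_le).trans hP)
  have hinv : ⅟(conj (z : ℂ)) = (z : ℂ) := rfl
  rw [hinv, eval₂_id, eval₂_id, eval_map_apply] at h
  rw [← h, mul_left_comm, ← mul_pow, hz', one_pow, mul_one]

/-- On the circle, conj(zP) z^n conj Φ_n = conj Φ_n · z^(n-1) conj P, and z^(n-1) conj P is again a
polynomial of degree below n. -/
lemma innerProd_X_mul_reversedPoly [IsProbabilityMeasure μ] (hμ : μ.support.Infinite) {n : ℕ}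
    {P : ℂ[X]} (hP : P.degree < n) : innerProd μ (X * P) (reversedPoly μ n) = 0 := by
  by_cases hP0 : P = 0
  · simp [hP0, innerProd]
  have hlt : P.natDegree < n := (natDegree_lt_iff_degree_lt hP0).mpr hP
  set R : ℂ[X] := (P.map (starRingEnd ℂ)).reflect (n - 1) with hR
  have hRd : R.degree < n := by
    have h1 : R.natDegree ≤ max (n - 1) (P.map (starRingEnd ℂ)).natDegree := natDegree_reflect_le
    have h2 : (P.map (starRingEnd ℂ)).natDegree ≤ P.natDegree := natDegree_map_le
    refine degree_le_natDegree.trans_lt ?_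
    have h3 : R.natDegree < n := by omega
    exact_mod_cast h3
  have h : innerProd μ (X * P) (reversedPoly μ n) = innerProd μ (monicPoly μ n) R := by
    unfold innerProd
    congr 1
    ext z
    rw [hR, eval_reflect_map_conj (by omega : P.natDegree ≤ n - 1) z, reversedPoly,
      eval_reflect_map_conj (natDegree_monicPoly μ n).le z]
    obtain ⟨m, rfl⟩ : ∃ m, n = m + 1 := ⟨n - 1, by omega⟩
    simp only [eval_mul, eval_X, map_mul, Nat.add_sub_cancel]
    linear_combination ((z : ℂ) ^ m * conj (P.eval (z : ℂ)) *
      conj ((monicPoly μ (m + 1)).eval (z : ℂ))) * conj_mul_self_of_sphere z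
  rw [h, ← innerProd_conj_symm, innerProd_monicPoly_of_degree_lt hμ hRd, map_zero]

lemma innerProd_reversedPoly_self (n : ℕ) :
    innerProd μ (reversedPoly μ n) (reversedPoly μ n) =
      innerProd μ (monicPoly μ n) (monicPoly μ n) := by
  unfold innerProd
  congr 1
  ext z
  rw [reversedPoly, eval_reflect_map_conj (natDegree_monicPoly μ n).le z]
  have h : conj (z : ℂ) ^ n * (z : ℂ) ^ n = 1 := by
    rw [← mul_pow, conj_mul_self_of_sphere, one_pow]
  simp only [map_mul, map_pow, Complex.conj_conj]
  linear_combination ((monicPoly μ n).eval (z : ℂ) * conj ((monicPoly μ n).eval (z : ℂ))) * h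

variable (μ) in
lemma reversedPoly_coeff_zero (n : ℕ) : (reversedPoly μ n).coeff 0 = 1 := by
  have h := (monicPoly_monic μ n).coeff_natDegree
  rw [natDegree_monicPoly] at h
  rw [reversedPoly, coeff_reflect, revAt_zero, coeff_map, h, map_one]

variable (μ) in
lemma natDegree_reversedPoly_le (n : ℕ) : (reversedPoly μ n).natDegree ≤ n := by
  refine natDegree_reflect_le.trans (max_le le_rfl ?_)
  exact natDegree_map_le.trans (natDegree_monicPoly μ n).le

variable (μ) in
lemma monicPoly_coeff_zero (n : ℕ) :
    (monicPoly μ (n + 1)).coeff 0 = -conj (verblunsky μ n) := by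
  rw [verblunsky, map_neg, Complex.conj_conj, neg_neg, coeff_zero_eq_eval_zero]

/-- The Szegő recurrence. -/
theorem monicPoly_succ [IsProbabilityMeasure μ] (hμ : μ.support.Infinite) (n : ℕ) :
    monicPoly μ (n + 1) =
      X * monicPoly μ n - C (conj (verblunsky μ n)) * reversedPoly μ n := by
  set D : ℂ[X] := monicPoly μ (n + 1) - X * monicPoly μ n +
    C (conj (verblunsky μ n)) * reversedPoly μ n with hD
  have hD0 : D.coeff 0 = 0 := by
    rw [hD, coeff_add, coeff_sub, coeff_C_mul, reversedPoly_coeff_zero, monicPoly_coeff_zero]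
    simp
  -- With D = XE and deg E < n, D is orthogonal to each of the three terms composing it, hence to
  -- itself.
  obtain ⟨E, hE⟩ : X ∣ D := X_dvd_iff.mpr hD0
  have hDdeg : D.degree < ((n + 1 : ℕ) : WithBot ℕ) := by
    refine (degree_add_le _ _).trans_lt (max_lt ?_ ?_)
    · have hq : monicPoly μ (n + 1) - X * monicPoly μ n =
          (monicPoly μ (n + 1) - X ^ (n + 1)) - X * (monicPoly μ n - X ^ n) := by ring
      rw [hq]
      refine (degree_sub_le _ _).trans_lt (max_lt (monicPoly_sub_degree_lt μ (n + 1)) ?_)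
      rw [degree_lt_iff_coeff_zero]
      intro j hj
      obtain ⟨i, rfl⟩ : ∃ i, j = i + 1 := ⟨j - 1, by omega⟩
      rw [coeff_X_mul]
      exact coeff_eq_zero_of_degree_lt
        ((monicPoly_sub_degree_lt μ n).trans_le (by exact_mod_cast (by omega : n ≤ i)))
    · rw [← smul_eq_C_mul]
      refine (degree_smul_le _ _).trans_lt (degree_le_natDegree.trans_lt ?_)
      exact_mod_cast Nat.lt_succ_of_le (natDegree_reversedPoly_le μ n)
  have hEdeg : E.degree < n := by
    rw [degree_lt_iff_coeff_zero]
    intro j hj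
    rw [← coeff_X_mul, ← hE]
    exact coeff_eq_zero_of_degree_lt (hDdeg.trans_le (by exact_mod_cast (by omega : n + 1 ≤ j + 1)))
  have hDD : innerProd μ D D = 0 := by
    have h1 : innerProd μ D (monicPoly μ (n + 1)) = 0 :=
      innerProd_monicPoly_of_degree_lt hμ hDdeg
    have h2 : innerProd μ D (X * monicPoly μ n) = 0 := by
      rw [hE, innerProd_X_mul_X_mul]
      exact innerProd_monicPoly_of_degree_lt hμ hEdeg
    have h3 : innerProd μ D (reversedPoly μ n) = 0 := by
      rw [hE]
      exact innerProd_X_mul_reversedPoly hμ hEdeg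
    have h4 : innerProd μ D D = innerProd μ D (monicPoly μ (n + 1) - X * monicPoly μ n +
      C (conj (verblunsky μ n)) * reversedPoly μ n) := by rw [← hD]
    rw [h4, innerProd_add_right, innerProd_sub_right, innerProd_C_mul_right, h1, h2, h3]
    ring
  have hzero := eq_zero_of_innerProd_self hμ hDD
  rw [hD] at hzero
  linear_combination hzero

theorem reversedPoly_succ [IsProbabilityMeasure μ] (hμ : μ.support.Infinite) (n : ℕ) :
    reversedPoly μ (n + 1) =
      reversedPoly μ n - C (verblunsky μ n) * (X * monicPoly μ n) := by
  have h1 : (X * (monicPoly μ n).map (starRingEnd ℂ)).reflect (n + 1) = reversedPoly μ n := by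
    have h := reflect_mul (X : ℂ[X]) ((monicPoly μ n).map (starRingEnd ℂ)) (F := 1) (G := n)
      natDegree_X_le (natDegree_map_le.trans (natDegree_monicPoly μ n).le)
    rw [add_comm 1 n, reflect_one_X, one_mul] at h
    exact h
  -- Reversing Φ_n^* at order n would return Φ_n; order n + 1 contributes the extra factor X.
  have h2 : ((reversedPoly μ n).map (starRingEnd ℂ)).reflect (n + 1) = X * monicPoly μ n := by
    have hconj : (starRingEnd ℂ).comp (starRingEnd ℂ) = RingHom.id ℂ := by
      ext x
      simp
    have hm : (reversedPoly μ n).map (starRingEnd ℂ) = (monicPoly μ n).reflect n := by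
      rw [reversedPoly, ← reflect_map, Polynomial.map_map, hconj, Polynomial.map_id]
    have h := reflect_mul (1 : ℂ[X]) ((monicPoly μ n).reflect n) (F := 1) (G := n)
      (by simp) (natDegree_reflect_le.trans (max_le le_rfl (natDegree_monicPoly μ n).le))
    rw [add_comm 1 n, one_mul, reflect_reflect, reflect_one, pow_one] at h
    rw [hm, h]
  rw [reversedPoly, monicPoly_succ hμ n, Polynomial.map_sub, Polynomial.map_mul,
    Polynomial.map_mul, map_X, map_C, reflect_sub, h1, reflect_C_mul, h2, Complex.conj_conj]

/-- Pythagoras: zΦ_n = Φ_{n+1} + conj α_n Φ_n^* is an orthogonal sum, while zΦ_n and Φ_n^* both have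
the norm of Φ_n. -/
lemma norm_verblunsky_le_one [IsProbabilityMeasure μ] (hμ : μ.support.Infinite) (n : ℕ) :
    ‖verblunsky μ n‖ ≤ 1 := by
  set r : ℕ → ℝ := fun n => ∫ z : Metric.sphere (0 : ℂ) 1, ‖(monicPoly μ n).eval (z : ℂ)‖ ^ 2 ∂μ
    with hr
  have hrn : ∀ n, innerProd μ (monicPoly μ n) (monicPoly μ n) = (r n : ℂ) := fun n =>
    innerProd_self_eq_integral μ _
  have hr0 : ∀ n, 0 ≤ r n := fun n => integral_nonneg fun z => by positivity
  have hrpos : 0 < r n := by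
    refine lt_of_le_of_ne (hr0 n) fun h => innerProd_monicPoly_self_ne_zero hμ n ?_
    rw [hrn, ← h, Complex.ofReal_zero]
  have horth : innerProd μ (monicPoly μ (n + 1)) (reversedPoly μ n) = 0 := by
    rw [← innerProd_conj_symm, innerProd_monicPoly_of_degree_lt hμ, map_zero]
    refine degree_le_natDegree.trans_lt ?_
    exact_mod_cast Nat.lt_succ_of_le (natDegree_reversedPoly_le μ n)
  have horth' : innerProd μ (reversedPoly μ n) (monicPoly μ (n + 1)) = 0 := by
    rw [← innerProd_conj_symm, horth, map_zero]
  have hX : X * monicPoly μ n =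
      monicPoly μ (n + 1) + C (conj (verblunsky μ n)) * reversedPoly μ n := by
    rw [monicPoly_succ hμ n]
    ring
  have key : (r n : ℂ) = r (n + 1) + verblunsky μ n * conj (verblunsky μ n) * r n := by
    have h := innerProd_X_mul_X_mul μ (monicPoly μ n) (monicPoly μ n)
    rw [hX, innerProd_add_right, innerProd_add_left, innerProd_add_left, innerProd_C_mul_right,
      innerProd_C_mul_left, innerProd_C_mul_right, innerProd_C_mul_left, horth, horth',
      innerProd_reversedPoly_self, hrn, hrn] at h
    rw [Complex.conj_conj] at h
    linear_combination -h
  rw [Complex.mul_conj, Complex.normSq_eq_norm_sq] at key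
  have key' : r n = r (n + 1) + ‖verblunsky μ n‖ ^ 2 * r n := by exact_mod_cast key
  have h1 := hr0 (n + 1)
  have h2 : ‖verblunsky μ n‖ ^ 2 ≤ 1 := by
    by_contra! h
    nlinarith
  exact (sq_le_one_iff₀ (norm_nonneg _)).mp h2

lemma monicPoly_zero : monicPoly μ 0 = 1 := by
  rw [monicPoly.eq_def]
  simp

lemma reversedPoly_zero : reversedPoly μ 0 = 1 := by
  rw [reversedPoly, monicPoly_zero]
  simp

end Orthogonal

/-! ### Zero-freeness of Φ_n^* and the uniform bound on Ω_n in the disk. -/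

section Disc

variable {μ : Measure (Metric.sphere (0 : ℂ) 1)}

/-- The difference of the squared norms factors as (|q|² - |p|²)(1 - |α|²). -/
lemma norm_sub_mul_le_norm_sub_mul {α p q : ℂ} (hα : ‖α‖ ≤ 1) (hpq : ‖p‖ ≤ ‖q‖) :
    ‖p - conj α * q‖ ≤ ‖q - α * p‖ := by
  have h : ‖q - α * p‖ ^ 2 - ‖p - conj α * q‖ ^ 2 =
      (‖q‖ ^ 2 - ‖p‖ ^ 2) * (1 - ‖α‖ ^ 2) := by
    simp only [← Complex.normSq_eq_norm_sq, Complex.normSq_apply, Complex.sub_re, Complex.sub_im,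
      Complex.mul_re, Complex.mul_im, Complex.conj_re, Complex.conj_im]
    ring
  have h1 : 0 ≤ ‖q‖ ^ 2 - ‖p‖ ^ 2 :=
    sub_nonneg.mpr (pow_le_pow_left₀ (norm_nonneg _) hpq 2)
  have h2 : 0 ≤ 1 - ‖α‖ ^ 2 := sub_nonneg.mpr (pow_le_one₀ (norm_nonneg _) hα)
  refine le_of_sq_le_sq ?_ (norm_nonneg _)
  nlinarith [mul_nonneg h1 h2]

lemma eval_reversedPoly_succ [IsProbabilityMeasure μ] (hμ : μ.support.Infinite) (n : ℕ) (z : ℂ) :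
    (reversedPoly μ (n + 1)).eval z =
      (reversedPoly μ n).eval z - verblunsky μ n * (z * (monicPoly μ n).eval z) := by
  rw [reversedPoly_succ hμ n]
  simp

lemma eval_monicPoly_succ [IsProbabilityMeasure μ] (hμ : μ.support.Infinite) (n : ℕ) (z : ℂ) :
    (monicPoly μ (n + 1)).eval z =
      z * (monicPoly μ n).eval z - conj (verblunsky μ n) * (reversedPoly μ n).eval z := by
  rw [monicPoly_succ hμ n]
  simp

/-- The two claims support each other in the induction: they give |zΦ_n| < |Φ_n^*|, so |α_n| ≤ 1
suffices to keep Φ_{n+1}^* from vanishing. -/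
lemma reversedPoly_eval_ne_zero_and_norm_le [IsProbabilityMeasure μ] (hμ : μ.support.Infinite)
    (n : ℕ) {z : ℂ} (hz : ‖z‖ < 1) :
    (reversedPoly μ n).eval z ≠ 0 ∧
      ‖(monicPoly μ n).eval z‖ ≤ ‖(reversedPoly μ n).eval z‖ := by
  induction n with
  | zero => simp [reversedPoly_zero, monicPoly_zero]
  | succ n ih =>
    obtain ⟨h0, hle⟩ := ih
    have hα := norm_verblunsky_le_one hμ n
    have hq : 0 < ‖(reversedPoly μ n).eval z‖ := norm_pos_iff.mpr h0
    have hp : ‖z * (monicPoly μ n).eval z‖ < ‖(reversedPoly μ n).eval z‖ := by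
      rw [norm_mul]
      calc ‖z‖ * ‖(monicPoly μ n).eval z‖ ≤ ‖z‖ * ‖(reversedPoly μ n).eval z‖ := by gcongr
        _ < 1 * ‖(reversedPoly μ n).eval z‖ := by gcongr
        _ = _ := one_mul _
    rw [eval_reversedPoly_succ hμ, eval_monicPoly_succ hμ]
    refine ⟨fun h => ?_, norm_sub_mul_le_norm_sub_mul hα hp.le⟩
    have h1 : ‖(reversedPoly μ n).eval z‖ ≤ ‖z * (monicPoly μ n).eval z‖ := by
      rw [sub_eq_zero.mp h, norm_mul]
      exact mul_le_of_le_one_left (norm_nonneg _) hα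
    exact absurd h1 (not_le.mpr hp)

lemma norm_ratio_le_two [IsProbabilityMeasure μ] (hμ : μ.support.Infinite) (n : ℕ) {z : ℂ}
    (hz : ‖z‖ < 1) : ‖ratio μ n z‖ ≤ 2 := by
  obtain ⟨h0, hle⟩ := reversedPoly_eval_ne_zero_and_norm_le hμ n hz
  rw [ratio, norm_div, div_le_iff₀ (norm_pos_iff.mpr h0), eval_reversedPoly_succ hμ]
  refine (norm_sub_le _ _).trans ?_
  have h : ‖verblunsky μ n * (z * (monicPoly μ n).eval z)‖ ≤ 1 * (1 * ‖(reversedPoly μ n).eval z‖) := by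
    rw [norm_mul, norm_mul]
    gcongr
    exact norm_verblunsky_le_one hμ n
  linarith

lemma differentiableOn_ratio [IsProbabilityMeasure μ] (hμ : μ.support.Infinite) (n : ℕ) :
    DifferentiableOn ℂ (ratio μ n) (Metric.ball 0 1) := by
  unfold ratio
  refine (reversedPoly μ (n + 1)).differentiable.differentiableOn.div
    (reversedPoly μ n).differentiable.differentiableOn fun z hz => ?_
  exact (reversedPoly_eval_ne_zero_and_norm_le hμ n (mem_ball_zero_iff.mp hz)).1

end Disc

/-! ### The abstract recurrence for formal power series. -/

section Series

open scoped PowerSeries.WithPiTopology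

variable {T : ℕ → ℕ → PowerSeries ℂ} {β : ℕ → ℕ → ℂ}

lemma coeff_zero_eq_of_recurrence
    (hT : ∀ n l, PowerSeries.X * T n (l + 1) =
      (1 - PowerSeries.X * T n 0) * T (n + 1) l + PowerSeries.C (β n (l + 1))) (n l : ℕ) :
    β n (l + 1) = -PowerSeries.coeff 0 (T (n + 1) l) := by
  have h := congrArg (PowerSeries.coeff 0) (hT n l)
  simp only [PowerSeries.coeff_zero_X_mul, map_add, sub_mul, one_mul, map_sub, mul_assoc,
    PowerSeries.coeff_zero_C, sub_zero] at h
  linear_combination -h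

lemma coeff_succ_eq_of_recurrence
    (hT : ∀ n l, PowerSeries.X * T n (l + 1) =
      (1 - PowerSeries.X * T n 0) * T (n + 1) l + PowerSeries.C (β n (l + 1))) (n l k : ℕ) :
    PowerSeries.coeff (k + 1) (T (n + 1) l) = PowerSeries.coeff k (T n (l + 1)) + PowerSeries.coeff k (T n 0 * T (n + 1) l) := by
  have h := congrArg (PowerSeries.coeff (k + 1)) (hT n l)
  simp only [PowerSeries.coeff_succ_X_mul, map_add, sub_mul, one_mul, map_sub, mul_assoc,
    PowerSeries.coeff_succ_C, add_zero] at h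
  linear_combination -h

/-- Convergence of the series with `l = 0` propagates along the recurrence to all parameters. -/
lemma exists_tendsto_parameter_of_tendsto_series
    (hT : ∀ n l, PowerSeries.X * T n (l + 1) =
      (1 - PowerSeries.X * T n 0) * T (n + 1) l + PowerSeries.C (β n (l + 1)))
    {V : PowerSeries ℂ} (hV : Tendsto (fun n => T n 0) atTop (𝓝 V)) (l : ℕ) :
    ∃ c, Tendsto (fun n => β n (l + 1)) atTop (𝓝 c) := by
  have hβ : ∀ l U, Tendsto (fun n => T n l) atTop (𝓝 U) →
      Tendsto (fun n => β n (l + 1)) atTop (𝓝 (-PowerSeries.coeff 0 U)) := by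
    intro l U hU
    simp_rw [coeff_zero_eq_of_recurrence hT]
    exact (((PowerSeries.WithPiTopology.tendsto_iff_coeff_tendsto _ _ _ _).mp
      (hU.comp (tendsto_add_atTop_nat 1))) 0).neg
  have hU : ∀ l, ∃ U, Tendsto (fun n => T n l) atTop (𝓝 U) := by
    intro l
    induction l with
    | zero => exact ⟨V, hV⟩
    | succ l ih =>
      obtain ⟨U, hU⟩ := ih
      have hC : Tendsto (fun n => PowerSeries.C (β n (l + 1))) atTop
          (𝓝 (PowerSeries.C (-PowerSeries.coeff 0 U))) :=
        (PowerSeries.WithPiTopology.continuous_C.tendsto _).comp (hβ l U hU)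
      have hS := ((tendsto_const_nhds (x := (1 : PowerSeries ℂ))).sub
        ((tendsto_const_nhds (x := (PowerSeries.X : PowerSeries ℂ))).mul hV)).mul
        (hU.comp (tendsto_add_atTop_nat 1)) |>.add hC
      have hS' := (PowerSeries.WithPiTopology.tendsto_iff_coeff_tendsto _ _ _ _).mp hS
      -- The limit of X * T n (l + 1), divided by X through a shift of coefficients.
      refine ⟨PowerSeries.mk fun k => PowerSeries.coeff (k + 1)
        ((1 - PowerSeries.X * V) * U + PowerSeries.C (-PowerSeries.coeff 0 U)),
        (PowerSeries.WithPiTopology.tendsto_iff_coeff_tendsto _ _ _ _).mpr fun k => ?_⟩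
      rw [PowerSeries.coeff_mk]
      refine (hS' (k + 1)).congr fun n => ?_
      simp only [Function.comp_apply]
      rw [← hT, PowerSeries.coeff_succ_X_mul]
  obtain ⟨U, hU⟩ := hU l
  exact ⟨_, hβ l U hU⟩

/-- Convergence of the parameters implies convergence of the series to the solution of the
limiting recurrence. -/
lemma tendsto_series_of_tendsto_parameter
    (hT : ∀ n l, PowerSeries.X * T n (l + 1) =
      (1 - PowerSeries.X * T n 0) * T (n + 1) l + PowerSeries.C (β n (l + 1)))
    {U : ℕ → PowerSeries ℂ} {c : ℕ → ℂ}
    (hU : ∀ l, PowerSeries.X * U (l + 1) =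
      (1 - PowerSeries.X * U 0) * U l + PowerSeries.C (c (l + 1)))
    (hβ : ∀ l, Tendsto (fun n => β n (l + 1)) atTop (𝓝 (c (l + 1)))) (l : ℕ) :
    Tendsto (fun n => T n l) atTop (𝓝 (U l)) := by
  have hU' : ∀ _ l : ℕ, PowerSeries.X * U (l + 1) =
      (1 - PowerSeries.X * U 0) * U l + PowerSeries.C (c (l + 1)) := fun _ l => hU l
  -- The limit is treated as a family constant in n, so the same coefficient formulas apply to it.
  have hU0 := fun l => coeff_zero_eq_of_recurrence (T := fun _ l => U l) (β := fun _ l => c l) hU' 0 l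
  have hUs := fun l => coeff_succ_eq_of_recurrence (T := fun _ l => U l) (β := fun _ l => c l) hU' 0 l
  have key : ∀ k l, Tendsto (fun n => PowerSeries.coeff k (T n l)) atTop (𝓝 (PowerSeries.coeff k (U l))) := by
    intro k
    -- The induction is on the coefficient index, for all l at once, since coefficient k + 1 at l
    -- calls on coefficient k at l + 1.
    induction k using Nat.strong_induction_on with
    | _ k ih =>
      intro l
      rw [← tendsto_add_atTop_iff_nat 1]
      cases k with
      | zero =>
        have h := (hβ l).neg
        simp_rw [coeff_zero_eq_of_recurrence hT, hU0, neg_neg] at h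
        exact h
      | succ k =>
        simp_rw [coeff_succ_eq_of_recurrence hT, hUs, PowerSeries.coeff_mul]
        refine (ih k (Nat.lt_succ_self k) (l + 1)).add (tendsto_finsetSum _ fun p hp => ?_)
        have hp' := Finset.HasAntidiagonal.mem_antidiagonal.mp hp
        exact (ih p.1 (by omega) 0).mul
          ((ih p.2 (by omega) l).comp (tendsto_add_atTop_nat 1))
  exact (PowerSeries.WithPiTopology.tendsto_iff_coeff_tendsto _ _ _ _).mpr fun k => key k l

end Series

/-! ### The recurrence for the series of α_{n+l} Φ_n/Φ_n^*. -/

section SchurSeries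

variable (μ : Measure (Metric.sphere (0 : ℂ) 1))

/-- The power series at `0` of `α_{n+l} Φ_n / Φ_n^*`. -/
noncomputable def schurSeries (n l : ℕ) : PowerSeries ℂ :=
  PowerSeries.C (verblunsky μ (n + l)) *
    ((monicPoly μ n : PowerSeries ℂ) * (reversedPoly μ n : PowerSeries ℂ)⁻¹)

lemma constantCoeff_reversedPoly (n : ℕ) :
    PowerSeries.constantCoeff (reversedPoly μ n : PowerSeries ℂ) = 1 := by
  rw [← PowerSeries.coeff_zero_eq_constantCoeff_apply, Polynomial.coeff_coe,
    reversedPoly_coeff_zero]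

lemma schurSeries_mul_reversedPoly (n l : ℕ) :
    schurSeries μ n l * (reversedPoly μ n : PowerSeries ℂ) =
      PowerSeries.C (verblunsky μ (n + l)) * (monicPoly μ n : PowerSeries ℂ) := by
  rw [schurSeries, mul_assoc, mul_assoc, PowerSeries.inv_mul_cancel _
    (by rw [constantCoeff_reversedPoly]; exact one_ne_zero), mul_one]

variable {μ}

lemma coe_reversedPoly_succ [IsProbabilityMeasure μ] (hμ : μ.support.Infinite) (n : ℕ) :
    (reversedPoly μ (n + 1) : PowerSeries ℂ) =
      (1 - PowerSeries.X * schurSeries μ n 0) * (reversedPoly μ n : PowerSeries ℂ) := by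
  rw [sub_mul, mul_assoc, schurSeries_mul_reversedPoly, reversedPoly_succ hμ n]
  push_cast
  rw [add_zero]
  ring

lemma X_mul_schurSeries_succ [IsProbabilityMeasure μ] (hμ : μ.support.Infinite) (n l : ℕ) :
    PowerSeries.X * schurSeries μ n (l + 1) =
      (1 - PowerSeries.X * schurSeries μ n 0) * schurSeries μ (n + 1) l +
        PowerSeries.C (verblunsky μ (n + (l + 1)) * conj (verblunsky μ n)) := by
  have h0 : (reversedPoly μ n : PowerSeries ℂ) ≠ 0 := fun h => by
    have h1 := constantCoeff_reversedPoly μ n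
    rw [h, map_zero] at h1
    exact zero_ne_one h1
  refine mul_right_cancel₀ h0 ?_
  have h1 := schurSeries_mul_reversedPoly μ n (l + 1)
  have h2 := schurSeries_mul_reversedPoly μ (n + 1) l
  have h3 := coe_reversedPoly_succ hμ n
  have h4 : (monicPoly μ (n + 1) : PowerSeries ℂ) = PowerSeries.X * (monicPoly μ n : PowerSeries ℂ) -
      PowerSeries.C (conj (verblunsky μ n)) * (reversedPoly μ n : PowerSeries ℂ) := by
    rw [monicPoly_succ hμ n]
    push_cast
    rfl
  have h5 : n + 1 + l = n + (l + 1) := by ring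
  rw [h5, h4, h3] at h2
  rw [map_mul]
  linear_combination PowerSeries.X * h1 - h2

end SchurSeries

/-! ### Taylor coefficients versus locally uniform convergence. -/

section Taylor

open scoped PowerSeries.WithPiTopology

/-- The Taylor series of `f` at `0`. -/
noncomputable def taylorAtZero (f : ℂ → ℂ) : PowerSeries ℂ :=
  PowerSeries.mk fun k => iteratedDeriv k f 0 / k.factorial

lemma taylorAtZero_congr {f g : ℂ → ℂ} (h : f =ᶠ[𝓝 0] g) : taylorAtZero f = taylorAtZero g := by
  ext k
  simp only [taylorAtZero, PowerSeries.coeff_mk]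
  rw [h.iteratedDeriv_eq]

lemma taylorAtZero_mul {f g : ℂ → ℂ} (hf : AnalyticAt ℂ f 0) (hg : AnalyticAt ℂ g 0) :
    taylorAtZero (f * g) = taylorAtZero f * taylorAtZero g := by
  ext k
  rw [PowerSeries.coeff_mul,
    Finset.Nat.sum_antidiagonal_eq_sum_range_succ_mk]
  simp only [taylorAtZero, PowerSeries.coeff_mk]
  rw [iteratedDeriv_mul hf.contDiffAt hg.contDiffAt, Finset.sum_div]
  refine Finset.sum_congr rfl fun i hi => ?_
  have hik : i ≤ k := Nat.lt_succ_iff.mp (Finset.mem_range.mp hi)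
  rw [Nat.cast_choose ℂ hik]
  have h1 : (k.factorial : ℂ) ≠ 0 := by exact_mod_cast k.factorial_ne_zero
  have h2 : (i.factorial : ℂ) ≠ 0 := by exact_mod_cast i.factorial_ne_zero
  have h3 : ((k - i).factorial : ℂ) ≠ 0 := by exact_mod_cast (k - i).factorial_ne_zero
  field_simp

lemma iteratedDeriv_polynomial_eval (P : ℂ[X]) (k : ℕ) :
    iteratedDeriv k (fun z => P.eval z) = fun z => (derivative^[k] P).eval z := by
  induction k generalizing P with
  | zero => simp
  | succ k ih =>
    rw [iteratedDeriv_succ', Function.iterate_succ_apply, ← ih]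
    congr 1
    ext z
    exact P.deriv

lemma taylorAtZero_polynomial (P : ℂ[X]) :
    taylorAtZero (fun z => P.eval z) = (P : PowerSeries ℂ) := by
  ext k
  simp only [taylorAtZero, PowerSeries.coeff_mk, Polynomial.coeff_coe]
  rw [iteratedDeriv_polynomial_eval]
  simp only
  rw [← coeff_zero_eq_eval_zero, coeff_iterate_derivative, zero_add, Nat.descFactorial_self,
    nsmul_eq_mul, mul_div_cancel_left₀]
  exact_mod_cast k.factorial_ne_zero

lemma taylorAtZero_sub {f g : ℂ → ℂ} (hf : AnalyticAt ℂ f 0) (hg : AnalyticAt ℂ g 0) :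
    taylorAtZero (f - g) = taylorAtZero f - taylorAtZero g := by
  ext k
  simp only [taylorAtZero, PowerSeries.coeff_mk, map_sub]
  rw [iteratedDeriv_sub hf.contDiffAt hg.contDiffAt, sub_div]

lemma norm_coeff_taylorAtZero_le {f : ℂ → ℂ} {M R : ℝ} (hf : DifferentiableOn ℂ f (Metric.ball 0 1))
    (hM : ∀ z, ‖z‖ < 1 → ‖f z‖ ≤ M) (hR0 : 0 < R) (hR1 : R < 1) (k : ℕ) :
    ‖PowerSeries.coeff k (taylorAtZero f)‖ ≤ M / R ^ k := by
  have hsub : Metric.closedBall (0 : ℂ) R ⊆ Metric.ball 0 1 := Metric.closedBall_subset_ball hR1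
  have h := Complex.norm_iteratedDeriv_le_of_forall_mem_sphere_norm_le (c := 0) (C := M) k hR0
    (hf.diffContOnCl_ball hsub)
    fun z hz => hM z (mem_ball_zero_iff.mp (hsub (Metric.sphere_subset_closedBall hz)))
  rw [taylorAtZero, PowerSeries.coeff_mk, norm_div, Complex.norm_natCast,
    div_le_iff₀ (by exact_mod_cast k.factorial_pos)]
  refine h.trans (le_of_eq ?_)
  ring

lemma hasSum_taylorAtZero {f : ℂ → ℂ} (hf : DifferentiableOn ℂ f (Metric.ball 0 1)) {z : ℂ}
    (hz : ‖z‖ < 1) :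
    HasSum (fun k => PowerSeries.coeff k (taylorAtZero f) * z ^ k) (f z) := by
  have h := Complex.hasSum_taylorSeries_on_ball hf (mem_ball_zero_iff.mpr hz)
  refine (congrArg (fun u => HasSum u (f z)) (funext fun k => ?_)).mpr h
  simp only [taylorAtZero, PowerSeries.coeff_mk, sub_zero, smul_eq_mul]
  ring

/-- Uniformly bounded analytic functions on the disc whose Taylor coefficients converge to those
of `g` converge to `g` uniformly on compact subsets. -/
theorem convergesOnCompacts_of_tendsto_taylorAtZero {F : ℕ → ℂ → ℂ} {g : ℂ → ℂ} {M : ℝ}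
    (hF : ∀ n, DifferentiableOn ℂ (F n) (Metric.ball 0 1))
    (hM : ∀ n z, ‖z‖ < 1 → ‖F n z‖ ≤ M) (hg : DifferentiableOn ℂ g (Metric.ball 0 1))
    (h : Tendsto (fun n => taylorAtZero (F n)) atTop (𝓝 (taylorAtZero g))) :
    ConvergesOnCompacts F g := by
  intro K hK hK1
  obtain ⟨r, hr0, hr1, hKr⟩ : ∃ r : ℝ, 0 ≤ r ∧ r < 1 ∧ ∀ z ∈ K, ‖z‖ ≤ r := by
    rcases K.eq_empty_or_nonempty with rfl | hne
    · exact ⟨0, le_rfl, one_pos, by simp⟩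
    · obtain ⟨w, hw, hmax⟩ := hK.exists_isMaxOn hne continuous_norm.continuousOn
      exact ⟨‖w‖, norm_nonneg _, mem_ball_zero_iff.mp (hK1 hw), fun z hz => hmax hz⟩
  -- Cauchy estimates on radius R against evaluation on radius r < R give the summable majorant
  -- (r/R)^k for dominated convergence.
  obtain ⟨R, hrR, hR1⟩ := exists_between hr1
  have hR0 : 0 < R := hr0.trans_lt hrR
  have hcoeff := (PowerSeries.WithPiTopology.tendsto_iff_coeff_tendsto _ _ _ _).mp h
  have hbF := fun n k => norm_coeff_taylorAtZero_le (hF n) (hM n) hR0 hR1 k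
  have hbg : ∀ k, ‖PowerSeries.coeff k (taylorAtZero g)‖ ≤ M / R ^ k := fun k =>
    le_of_tendsto (hcoeff k).norm (Eventually.of_forall fun n => hbF n k)
  set d : ℕ → ℕ → ℝ := fun n k => ‖PowerSeries.coeff k (taylorAtZero (F n)) -
    PowerSeries.coeff k (taylorAtZero g)‖ * r ^ k with hd
  have hdb : ∀ n k, d n k ≤ 2 * M * (r / R) ^ k := by
    intro n k
    have h1 := (norm_sub_le (PowerSeries.coeff k (taylorAtZero (F n)))
      (PowerSeries.coeff k (taylorAtZero g))).trans (add_le_add (hbF n k) (hbg k))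
    calc d n k ≤ (M / R ^ k + M / R ^ k) * r ^ k := by
          simp only [hd]; gcongr
      _ = 2 * M * (r / R) ^ k := by rw [div_pow]; ring
  have hd0 : ∀ n k, 0 ≤ d n k := fun n k => by simp only [hd]; positivity
  have hsum : Summable fun k : ℕ => 2 * M * (r / R) ^ k :=
    (summable_geometric_of_lt_one (by positivity) ((div_lt_one hR0).mpr hrR)).mul_left _
  have hds : ∀ n, Summable (d n) := fun n => hsum.of_nonneg_of_le (hd0 n) (hdb n)
  have hlim : Tendsto (fun n => ∑' k, d n k) atTop (𝓝 (∑' _ : ℕ, (0 : ℝ))) := by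
    refine tendsto_tsum_of_dominated_convergence hsum (fun k => ?_)
      (Eventually.of_forall fun n k => ?_)
    · have h1 := (((hcoeff k).sub_const (PowerSeries.coeff k (taylorAtZero g))).norm).mul_const
        (r ^ k)
      simpa [hd] using h1
    · rw [Real.norm_of_nonneg (hd0 n k)]
      exact hdb n k
  rw [tsum_zero] at hlim
  rw [Metric.tendstoUniformlyOn_iff]
  intro ε hε
  filter_upwards [hlim.eventually_lt_const hε] with n hn z hz
  have hz1 : ‖z‖ < 1 := (hKr z hz).trans_lt hr1
  have hdiff := (hasSum_taylorAtZero (hF n) hz1).sub (hasSum_taylorAtZero hg hz1)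
  rw [dist_comm, dist_eq_norm, ← hdiff.tsum_eq]
  refine (tsum_of_norm_bounded (hds n).hasSum fun k => ?_).trans_lt hn
  rw [← sub_mul, norm_mul, norm_pow]
  simp only [hd]
  gcongr
  exact hKr z hz

/-- Taylor coefficients converge under uniform convergence on compact subsets of the disc. -/
theorem tendsto_taylorAtZero_of_convergesOnCompacts {F : ℕ → ℂ → ℂ} {g : ℂ → ℂ}
    (hF : ∀ n, DifferentiableOn ℂ (F n) (Metric.ball 0 1)) (h : ConvergesOnCompacts F g) :
    Tendsto (fun n => taylorAtZero (F n)) atTop (𝓝 (taylorAtZero g)) := by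
  have hloc : ∀ k, (∀ n, DifferentiableOn ℂ (iteratedDeriv k (F n)) (Metric.ball 0 1)) ∧
      TendstoLocallyUniformlyOn (fun n => iteratedDeriv k (F n)) (iteratedDeriv k g) atTop
        (Metric.ball 0 1) := by
    intro k
    induction k with
    | zero =>
      simp only [iteratedDeriv_zero]
      exact ⟨hF, (tendstoLocallyUniformlyOn_iff_forall_isCompact Metric.isOpen_ball).mpr
        fun K hK1 hK => h K hK hK1⟩
    | succ k ih =>
      simp only [iteratedDeriv_succ]
      exact ⟨fun n => (ih.1 n).deriv Metric.isOpen_ball,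
        ih.2.deriv (Eventually.of_forall ih.1) Metric.isOpen_ball⟩
  refine (PowerSeries.WithPiTopology.tendsto_iff_coeff_tendsto _ _ _ _).mpr fun k => ?_
  simp only [taylorAtZero, PowerSeries.coeff_mk]
  exact ((hloc k).2.tendsto_at (Metric.mem_ball_self one_pos)).div_const _

end Taylor

/-! ### Analyticity and quadratic equation of G_a. -/

section Limit

/-- For w = x + iy the imaginary part is 2y(x + 2a² - 1). If y = 0, the real part is (1 - a²)(1 -
x)² + a²(1 + x)² > 0; if 2a² = 1 - x, it is 1 - x² - y² > 0. -/
lemma mem_slitPlane_discriminant {a : ℝ} (ha0 : 0 ≤ a) (ha1 : a ≤ 1) {w : ℂ} (hw : ‖w‖ < 1) :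
    (1 - w) ^ 2 + 4 * (a : ℂ) ^ 2 * w ∈ Complex.slitPlane := by
  have hn : w.re ^ 2 + w.im ^ 2 < 1 := by
    have h : ‖w‖ ^ 2 < 1 := pow_lt_one₀ (norm_nonneg _) hw two_ne_zero
    rw [← Complex.normSq_eq_norm_sq, Complex.normSq_apply] at h
    nlinarith
  have hre : ((1 - w) ^ 2 + 4 * (a : ℂ) ^ 2 * w).re =
      (1 - w.re) ^ 2 - w.im ^ 2 + 4 * a ^ 2 * w.re := by
    simp [pow_two]
  have him : ((1 - w) ^ 2 + 4 * (a : ℂ) ^ 2 * w).im =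
      2 * w.im * (w.re + (2 * a ^ 2 - 1)) := by
    simp [pow_two]
    ring
  rw [Complex.mem_slitPlane_iff, hre, him]
  by_contra! hcon
  obtain ⟨h1, h2⟩ := hcon
  have ha2 : a ^ 2 ≤ 1 := pow_le_one₀ ha0 ha1
  rcases mul_eq_zero.mp h2 with h | h
  · have hy : w.im = 0 := by linarith
    have hx := abs_lt.mp ((sq_lt_one_iff_abs_lt_one _).mp (by nlinarith : w.re ^ 2 < 1))
    rw [hy] at h1
    nlinarith [sq_nonneg a, mul_nonneg (sq_nonneg a) (by linarith : 0 ≤ 1 + w.re),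
      mul_nonneg (by linarith : 0 ≤ 1 - a ^ 2) (by linarith : 0 ≤ 1 - w.re),
      mul_pos (by linarith : 0 < 1 + w.re) (by linarith : 0 < 1 + w.re),
      mul_pos (by linarith : 0 < 1 - w.re) (by linarith : 0 < 1 - w.re)]
  · have hx : a ^ 2 = (1 - w.re) / 2 := by linarith
    rw [hx] at h1
    nlinarith

lemma G_quadratic (a : ℝ) (w : ℂ) :
    G a w * G a w - (1 + w) * G a w = -(w * (1 - (a : ℂ) ^ 2)) := by
  have h : Complex.sqrt ((1 - w) ^ 2 + 4 * (a : ℂ) ^ 2 * w) ^ 2 =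
      (1 - w) ^ 2 + 4 * (a : ℂ) ^ 2 * w := by
    rw [Complex.sqrt]
    exact Complex.cpow_ofNat_inv_pow _ 2
  unfold G
  linear_combination (1 / 4 : ℂ) * h

lemma G_zero (a : ℝ) : G a 0 = 1 := by
  norm_num [G]

lemma differentiableOn_G_comp_mul {a : ℝ} (ha0 : 0 ≤ a) (ha1 : a ≤ 1) {lam : ℂ} (hl : ‖lam‖ = 1) :
    DifferentiableOn ℂ (fun z => G a (lam * z)) (Metric.ball 0 1) := by
  intro z hz
  have hz1 : ‖lam * z‖ < 1 := by
    rw [norm_mul, hl, one_mul]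
    exact mem_ball_zero_iff.mp hz
  have hs := mem_slitPlane_discriminant ha0 ha1 hz1
  refine DifferentiableAt.differentiableWithinAt ?_
  unfold G Complex.sqrt
  refine DifferentiableAt.const_mul (DifferentiableAt.add (by fun_prop) ?_) _
  exact DifferentiableAt.cpow_const (by fun_prop) hs

/-- `G_a(λ z) = 1 - z V(z)` as power series, where `V - z V² = λ z V - a² λ`. -/
lemma exists_series_of_G {a : ℝ} (ha0 : 0 ≤ a) (ha1 : a ≤ 1) {lam : ℂ} (hl : ‖lam‖ = 1) :
    ∃ V : PowerSeries ℂ, taylorAtZero (fun z => G a (lam * z)) = 1 - PowerSeries.X * V ∧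
      (1 - PowerSeries.X * V) * V =
        PowerSeries.C lam * PowerSeries.X * V - PowerSeries.C ((a : ℂ) ^ 2 * lam) := by
  set g : ℂ → ℂ := fun z => G a (lam * z) with hg
  have hga : AnalyticAt ℂ g 0 :=
    (differentiableOn_G_comp_mul ha0 ha1 hl).analyticAt (Metric.ball_mem_nhds 0 one_pos)
  obtain ⟨V, hV⟩ : PowerSeries.X ∣ 1 - taylorAtZero g := by
    rw [PowerSeries.X_dvd_iff, ← PowerSeries.coeff_zero_eq_constantCoeff_apply, map_sub,
      taylorAtZero, PowerSeries.coeff_mk]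
    simp [hg, G_zero]
  have hV' : taylorAtZero g = 1 - PowerSeries.X * V := by rw [← hV]; ring
  refine ⟨V, hV', ?_⟩
  let p : ℂ[X] := 1 + C lam * X
  let q : ℂ[X] := -(C lam * X * (1 - C ((a : ℂ) ^ 2)))
  have hp : AnalyticAt ℂ (fun z => p.eval z) 0 := p.differentiable.analyticAt 0
  have hfun : g * g - (fun z => p.eval z) * g = fun z => q.eval z := by
    ext z
    have := G_quadratic a (lam * z)
    simpa [p, q, hg] using this
  have hser := congrArg taylorAtZero hfun
  rw [taylorAtZero_sub (hga.mul hga) (hp.mul hga), taylorAtZero_mul hga hga,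
    taylorAtZero_mul hp hga, taylorAtZero_polynomial, taylorAtZero_polynomial, hV'] at hser
  simp only [p, q, Polynomial.coe_add, Polynomial.coe_mul, Polynomial.coe_one, Polynomial.coe_C,
    Polynomial.coe_X, Polynomial.coe_neg, Polynomial.coe_sub] at hser
  refine mul_left_cancel₀ PowerSeries.X_ne_zero ?_
  rw [map_mul]
  linear_combination -hser

end Limit

/-! ### The form of the limits c_l. -/

section Parameters

/-- Limits of `α_{n+l} conj α_n` for a bounded sequence have the form `a² λ^l`. -/
theorem exists_eq_sq_mul_pow_of_tendsto {α : ℕ → ℂ} (hα : ∀ n, ‖α n‖ ≤ 1) {c : ℕ → ℂ}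
    (hc : ∀ l, 1 ≤ l → Tendsto (fun n => α (n + l) * conj (α n)) atTop (𝓝 (c l))) :
    ∃ a : ℝ, 0 ≤ a ∧ a ≤ 1 ∧ ∃ lam : ℂ, ‖lam‖ = 1 ∧
      ∀ l : ℕ, 1 ≤ l → c l = (a : ℂ) ^ 2 * lam ^ l := by
  by_cases h0 : ∀ l, 1 ≤ l → c l = 0
  · exact ⟨0, le_rfl, zero_le_one, 1, by simp, fun l hl => by simp [h0 l hl]⟩
  push Not at h0
  obtain ⟨L, hL, hcL⟩ := h0
  have hprod : ∀ l m, 1 ≤ l → 1 ≤ m → Tendsto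
      (fun n => (α (n + m + l) * conj (α n)) * ((‖α (n + m)‖ ^ 2 : ℝ) : ℂ)) atTop
      (𝓝 (c l * c m)) := by
    intro l m hl hm
    refine (((hc l hl).comp (tendsto_add_atTop_nat m)).mul (hc m hm)).congr fun n => ?_
    simp only [Function.comp_apply]
    rw [← Complex.normSq_eq_norm_sq, ← Complex.mul_conj]
    ring
  have hsum : ∀ l m, 1 ≤ l → Tendsto (fun n => α (n + m + l) * conj (α n)) atTop (𝓝 (c (l + m))) := by
    intro l m hl
    refine (hc (l + m) (by omega)).congr fun n => ?_
    rw [show n + (l + m) = n + m + l by ring]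
  -- The product converging to c_L² is α_{n+2L} conj α_n times |α_{n+L}|² ≤ 1, so c_{2L} = 0 would
  -- force c_L = 0.
  have hc2L : c (L + L) ≠ 0 := by
    intro h
    have hz : Tendsto (fun n => (α (n + L + L) * conj (α n)) * ((‖α (n + L)‖ ^ 2 : ℝ) : ℂ)) atTop
        (𝓝 0) := by
      have h1 := hsum L L hL
      rw [h] at h1
      refine squeeze_zero_norm (fun n => ?_) (tendsto_zero_iff_norm_tendsto_zero.mp h1)
      rw [norm_mul, Complex.norm_real, Real.norm_of_nonneg (by positivity)]
      exact mul_le_of_le_one_right (norm_nonneg _) (pow_le_one₀ (norm_nonneg _) (hα _))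
    have h2 := tendsto_nhds_unique hz (hprod L L hL hL)
    exact mul_ne_zero hcL hcL h2.symm
  -- Cancelling α_{n+2L} conj α_n from that product identifies A as the limit of |α_n|².
  set A : ℂ := c L * c L / c (L + L) with hA
  have hAlim : Tendsto (fun n => ((‖α n‖ ^ 2 : ℝ) : ℂ)) atTop (𝓝 A) := by
    rw [← tendsto_add_atTop_iff_nat L]
    have h1 := hsum L L hL
    refine ((hprod L L hL hL).div h1 hc2L).congr' ?_
    filter_upwards [h1.eventually_ne hc2L] with n hn
    simp only [Pi.div_apply]
    exact mul_div_cancel_left₀ _ hn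
  have hAre : Tendsto (fun n => ‖α n‖ ^ 2) atTop (𝓝 A.re) :=
    (Complex.continuous_re.tendsto A).comp hAlim
  have hA0 : 0 ≤ A.re := ge_of_tendsto hAre (Eventually.of_forall fun n => by positivity)
  have hA1 : A.re ≤ 1 := le_of_tendsto hAre (Eventually.of_forall fun n =>
    pow_le_one₀ (norm_nonneg _) (hα n))
  have hAA : A = (A.re : ℂ) := by
    refine tendsto_nhds_unique hAlim ?_
    exact (Complex.continuous_ofReal.tendsto _).comp hAre
  have hAne : A ≠ 0 := div_ne_zero (mul_ne_zero hcL hcL) hc2L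
  have hmul : ∀ l m, 1 ≤ l → 1 ≤ m → c (l + m) * A = c l * c m := fun l m hl hm =>
    tendsto_nhds_unique
      ((hsum l m hl).mul (hAlim.comp (tendsto_add_atTop_nat m))) (hprod l m hl hm)
  have hnorm1 : ‖c 1‖ = A.re := by
    have hn : Tendsto (fun n => ‖α n‖) atTop (𝓝 (√A.re)) := by
      refine ((Real.continuous_sqrt.tendsto _).comp hAre).congr fun n => ?_
      simp [Real.sqrt_sq (norm_nonneg _)]
    have h1 := (hc 1 le_rfl).norm
    have h2 := (hn.comp (tendsto_add_atTop_nat 1)).mul hn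
    rw [Real.mul_self_sqrt hA0] at h2
    refine tendsto_nhds_unique h1 (h2.congr fun n => ?_)
    simp
  have hApos : 0 < A.re := lt_of_le_of_ne hA0 fun h => hAne (by rw [hAA, ← h, Complex.ofReal_zero])
  -- Here a² = A, and λ is unimodular because |α_{n+1}||α_n| tends to A; `hmul` makes c_l/A
  -- multiplicative in l.
  refine ⟨√A.re, Real.sqrt_nonneg _, Real.sqrt_le_one.mpr hA1, c 1 / A, ?_, ?_⟩
  · have hAnorm : ‖A‖ = A.re := by
      rw [hAA, Complex.norm_real, Complex.ofReal_re, Real.norm_of_nonneg hA0]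
    rw [norm_div, hnorm1, hAnorm, div_self hApos.ne']
  · have hsq : ((√A.re : ℝ) : ℂ) ^ 2 = A := by
      rw [← Complex.ofReal_pow, Real.sq_sqrt hA0, ← hAA]
    intro l hl
    rw [hsq]
    induction l, hl using Nat.le_induction with
    | base => field_simp
    | succ l hl ih =>
      have h := hmul l 1 hl le_rfl
      refine mul_right_cancel₀ hAne ?_
      rw [h, ih, pow_succ]
      field_simp

end Parameters

/-! ### Transfer between Ω_n and the Verblunsky coefficients. -/

section RatioAsymptotics

open scoped PowerSeries.WithPiTopology

variable {μ : Measure (Metric.sphere (0 : ℂ) 1)} [IsProbabilityMeasure μ]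

lemma taylorAtZero_ratio (hμ : μ.support.Infinite) (n : ℕ) :
    taylorAtZero (ratio μ n) = 1 - PowerSeries.X * schurSeries μ n 0 := by
  have h0 : (reversedPoly μ n : PowerSeries ℂ) ≠ 0 := fun h => by
    have h1 := constantCoeff_reversedPoly μ n
    rw [h, map_zero] at h1
    exact zero_ne_one h1
  have hr : AnalyticAt ℂ (ratio μ n) 0 :=
    (differentiableOn_ratio hμ n).analyticAt (Metric.ball_mem_nhds 0 one_pos)
  have hp : AnalyticAt ℂ (fun z => (reversedPoly μ n).eval z) 0 :=
    (reversedPoly μ n).differentiable.analyticAt 0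
  refine mul_right_cancel₀ h0 ?_
  rw [← coe_reversedPoly_succ hμ, ← taylorAtZero_polynomial, ← taylorAtZero_polynomial,
    ← taylorAtZero_mul hr hp]
  refine taylorAtZero_congr ?_
  filter_upwards [Metric.ball_mem_nhds (0 : ℂ) one_pos] with z hz
  simp only [Pi.mul_apply, ratio]
  exact div_mul_cancel₀ _
    (reversedPoly_eval_ne_zero_and_norm_le hμ n (mem_ball_zero_iff.mp hz)).1

theorem exists_tendsto_verblunsky_of_convergesOnCompacts (hμ : μ.support.Infinite) {g : ℂ → ℂ}
    (h : ConvergesOnCompacts (ratio μ) g) {l : ℕ} (hl : 1 ≤ l) :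
    ∃ c : ℂ, Tendsto (fun n => verblunsky μ (n + l) * conj (verblunsky μ n)) atTop (𝓝 c) := by
  have h1 := tendsto_taylorAtZero_of_convergesOnCompacts (differentiableOn_ratio hμ) h
  have h2 : Tendsto (fun n => schurSeries μ n 0) atTop
      (𝓝 (PowerSeries.mk fun k => PowerSeries.coeff (k + 1) (1 - taylorAtZero g))) := by
    refine (PowerSeries.WithPiTopology.tendsto_iff_coeff_tendsto _ _ _ _).mpr fun k => ?_
    rw [PowerSeries.coeff_mk]
    refine ((PowerSeries.WithPiTopology.tendsto_iff_coeff_tendsto _ _ _ _).mp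
      (h1.const_sub 1) (k + 1)).congr fun n => ?_
    rw [taylorAtZero_ratio hμ, sub_sub_cancel, PowerSeries.coeff_succ_X_mul]
  obtain ⟨m, rfl⟩ : ∃ m, l = m + 1 := ⟨l - 1, by omega⟩
  exact exists_tendsto_parameter_of_tendsto_series
    (β := fun n l => verblunsky μ (n + l) * conj (verblunsky μ n))
    (X_mul_schurSeries_succ hμ) h2 m

theorem convergesOnCompacts_ratio_of_tendsto (hμ : μ.support.Infinite) {a : ℝ} (ha0 : 0 ≤ a)
    (ha1 : a ≤ 1) {lam : ℂ} (hlam : ‖lam‖ = 1)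
    (h : ∀ l : ℕ, 1 ≤ l → Tendsto (fun n => verblunsky μ (n + l) * conj (verblunsky μ n)) atTop
      (𝓝 ((a : ℂ) ^ 2 * lam ^ l))) :
    ConvergesOnCompacts (ratio μ) (fun z => G a (lam * z)) := by
  obtain ⟨V, hV, hVeq⟩ := exists_series_of_G ha0 ha1 hlam
  -- With the ansatz λ^l V, the limiting recurrence at every l is λ^l times the single quadratic
  -- equation for V.
  have hU : ∀ l : ℕ, PowerSeries.X * (PowerSeries.C (lam ^ (l + 1)) * V) =
      (1 - PowerSeries.X * (PowerSeries.C (lam ^ 0) * V)) * (PowerSeries.C (lam ^ l) * V) +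
        PowerSeries.C ((a : ℂ) ^ 2 * lam ^ (l + 1)) := by
    intro l
    rw [pow_zero, map_one, one_mul, pow_succ, map_mul, map_mul, map_mul]
    rw [map_mul] at hVeq
    linear_combination -(PowerSeries.C (lam ^ l)) * hVeq
  have hT := tendsto_series_of_tendsto_parameter
    (β := fun n l => verblunsky μ (n + l) * conj (verblunsky μ n))
    (U := fun l => PowerSeries.C (lam ^ l) * V) (c := fun l => (a : ℂ) ^ 2 * lam ^ l)
    (X_mul_schurSeries_succ hμ) hU (fun l => h (l + 1) (by omega)) 0
  refine convergesOnCompacts_of_tendsto_taylorAtZero (differentiableOn_ratio hμ)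
    (fun n z hz => norm_ratio_le_two hμ n hz) (differentiableOn_G_comp_mul ha0 ha1 hlam) ?_
  simp_rw [taylorAtZero_ratio hμ]
  rw [hV]
  simp only [pow_zero, map_one, one_mul] at hT
  exact tendsto_const_nhds.sub (tendsto_const_nhds.mul hT)

end RatioAsymptotics

end OPUC

theorem theorem4p2 (μ : Measure (Metric.sphere (0 : ℂ) 1)) [IsProbabilityMeasure μ] (hμ : μ.support.Infinite) :
    ((∃ g : ℂ → ℂ, OPUC.ConvergesOnCompacts (OPUC.ratio μ) g) ↔
      ∀ l : ℕ, 1 ≤ l → ∃ c : ℂ, ‖c‖ ≤ 1 ∧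
        Tendsto (fun n : ℕ => OPUC.verblunsky μ (n + l) * conj (OPUC.verblunsky μ n))
          atTop (𝓝 c)) ∧
    (∀ c : ℕ → ℂ,
      (∀ l : ℕ, 1 ≤ l →
        Tendsto (fun n : ℕ => OPUC.verblunsky μ (n + l) * conj (OPUC.verblunsky μ n))
          atTop (𝓝 (c l))) →
      ∃ a : ℝ, 0 ≤ a ∧ a ≤ 1 ∧ ∃ lam : ℂ, ‖lam‖ = 1 ∧
        (∀ l : ℕ, 1 ≤ l → c l = (a : ℂ) ^ 2 * lam ^ l) ∧
        OPUC.ConvergesOnCompacts (OPUC.ratio μ) (fun z => OPUC.G a (lam * z))) := by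
  have hlimit : ∀ c : ℕ → ℂ,
      (∀ l : ℕ, 1 ≤ l →
        Tendsto (fun n : ℕ => OPUC.verblunsky μ (n + l) * conj (OPUC.verblunsky μ n))
          atTop (𝓝 (c l))) →
      ∃ a : ℝ, 0 ≤ a ∧ a ≤ 1 ∧ ∃ lam : ℂ, ‖lam‖ = 1 ∧
        (∀ l : ℕ, 1 ≤ l → c l = (a : ℂ) ^ 2 * lam ^ l) ∧
        OPUC.ConvergesOnCompacts (OPUC.ratio μ) (fun z => OPUC.G a (lam * z)) := by
    intro c hc
    obtain ⟨a, ha0, ha1, lam, hlam, heq⟩ :=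
      OPUC.exists_eq_sq_mul_pow_of_tendsto (OPUC.norm_verblunsky_le_one hμ) hc
    exact ⟨a, ha0, ha1, lam, hlam, heq,
      OPUC.convergesOnCompacts_ratio_of_tendsto hμ ha0 ha1 hlam fun l hl => heq l hl ▸ hc l hl⟩
  refine ⟨⟨?_, fun h => ?_⟩, hlimit⟩
  · rintro ⟨g, hg⟩ l hl
    obtain ⟨c, hc⟩ := OPUC.exists_tendsto_verblunsky_of_convergesOnCompacts hμ hg hl
    refine ⟨c, le_of_tendsto hc.norm (Eventually.of_forall fun n => ?_), hc⟩
    rw [norm_mul, RCLike.norm_conj]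
    exact mul_le_one₀ (OPUC.norm_verblunsky_le_one hμ _) (norm_nonneg _)
      (OPUC.norm_verblunsky_le_one hμ _)
  · have h' : ∀ l : ℕ, ∃ c : ℂ, 1 ≤ l →
        Tendsto (fun n : ℕ => OPUC.verblunsky μ (n + l) * conj (OPUC.verblunsky μ n))
          atTop (𝓝 c) := by
      intro l
      by_cases hl : 1 ≤ l
      · obtain ⟨c, -, hc⟩ := h l hl
        exact ⟨c, fun _ => hc⟩
      · exact ⟨0, fun h => absurd h hl⟩
    choose c hc using h'
    obtain ⟨a, -, -, lam, -, -, hconv⟩ := hlimit c hc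
    exact ⟨_, hconv⟩
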